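/- Let $K$ be a compact Hausdorff space, let $\varphi : K \to K$ be a homeomorphism of $K$ onto its image with $\varphi(K) \subsetneqq K$, and let $w \in C(K)$, where $C(K)$ denotes the Banach space of all complex-valued continuous functions on $K$ with the supremum norm. Let $T$ be the weighted composition operator on $C(K)$ defined by $$(Tf)(k) = w(k) f(\varphi(k)), \qquad f \in C(K),\ k \in K.$$ Put $$L = \bigcap_{n=0}^\infty \varphi^n(K), \qquad M = K \setminus \mathrm{Int}_K L .$$ The closed sets $L$ and $M$ satisfy $\varphi(L) \subseteq L$ and $\varphi(M) \subseteq M$, so the same formula defines bounded operators on $C(L)$ and on $C(M)$. Let $\sigma(T)$ be the spectrum of $T$ on $C(K)$, let $\sigma(T, C(L))$ and $\sigma(T, C(M))$ be the spectra of the operators on $C(L)$ and $C(M)$, and let $\rho(T, C(M))$ be the spectral radius of the operator on $C(M)$. Then: (I) $\sigma(T, C(M))$ is either the closed disk $\{\lambda \in \mathbb{C} : |\lambda| \le \rho(T, C(M))\}$ or the singleton $\{0\}$; (II) $\sigma(T) = \sigma(T, C(M)) \cup \sigma(T, C(L))$. -/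

import Mathlib

noncomputable section

namespace WeightedComposition

/-- The weighted composition operator `(T f)(x) = w(x) f(φ(x))` on `C(X)`. -/
def op {X : Type*} [TopologicalSpace X] [CompactSpace X] (w : C(X, ℂ)) (φ : C(X, X)) :
    C(X, ℂ) →L[ℂ] C(X, ℂ) :=
  LinearMap.mkContinuous
    { toFun := fun f => w * f.comp φ
      map_add' := fun f g => by ext x; simp [mul_add]
      map_smul' := fun c f => by ext x; simp }
    ‖w‖
    (fun f => by
      refine (norm_mul_le _ _).trans (mul_le_mul_of_nonneg_left ?_ (norm_nonneg w))
      exact (ContinuousMap.norm_le _ (norm_nonneg f)).2 fun x => f.norm_coe_le_norm (φ x))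

theorem op_apply {X : Type*} [TopologicalSpace X] [CompactSpace X] (w : C(X, ℂ)) (φ : C(X, X))
    (f : C(X, ℂ)) (x : X) : op w φ f x = w x * f (φ x) := rfl

/-- The operator given by the same formula on `C(S)`, for a compact `φ`-invariant subset `S`. -/
def opOn {X : Type*} [TopologicalSpace X] (w : C(X, ℂ)) (φ : C(X, X)) (S : Set X) [CompactSpace S]
    (hS : Set.MapsTo φ S S) : C(S, ℂ) →L[ℂ] C(S, ℂ) :=
  op (w.restrict S) ⟨hS.restrict φ S S, φ.continuous.restrict hS⟩

variable {K : Type*} [TopologicalSpace K]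

/-- `L = ⋂_{n ≥ 0} φⁿ(K)`. -/
def L (φ : C(K, K)) : Set K := ⋂ n : ℕ, Set.range (φ^[n])

/-- `M = K \ Int L`. -/
def M (φ : C(K, K)) : Set K := (interior (L φ))ᶜ

theorem mapsTo_L (φ : C(K, K)) : Set.MapsTo φ (L φ) (L φ) := by
  intro x hx
  refine Set.mem_iInter.2 fun n => ?_
  obtain ⟨y, rfl⟩ := Set.mem_iInter.1 hx n
  exact ⟨φ y, by rw [← Function.iterate_succ_apply, Function.iterate_succ_apply']⟩

theorem mapsTo_M (φ : C(K, K)) (hφ : Function.Injective φ) : Set.MapsTo φ (M φ) (M φ) := by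
  intro x hx hx'
  refine hx (interior_maximal ?_ (isOpen_interior.preimage φ.continuous) hx')
  intro z hz
  refine Set.mem_iInter.2 fun n => ?_
  obtain ⟨y, hy⟩ := Set.mem_iInter.1 (interior_subset hz) (n + 1)
  rw [Function.iterate_succ_apply'] at hy
  exact ⟨y, hφ hy⟩

instance compactSpace_L [CompactSpace K] [T2Space K] (φ : C(K, K)) : CompactSpace (L φ) :=
  isCompact_iff_compactSpace.1
    (isClosed_iInter fun n => (isCompact_range (φ.continuous.iterate n)).isClosed).isCompact

instance compactSpace_M [CompactSpace K] (φ : C(K, K)) : CompactSpace (M φ) :=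
  isCompact_iff_compactSpace.1 isOpen_interior.isClosed_compl.isCompact

end WeightedComposition

end

/-! The powers of `T` are `Tⁿ f = wₙ · (f ∘ φⁿ)` with `wₙ = ∏_{k < n} w ∘ φᵏ`, so `‖Tⁿ‖ = ‖wₙ‖`.
A point `x` outside `L` has an injective orbit and no preimage under some `φᵐ`:
for each `n` there are a bump `g` of norm one with `g (φⁿ x) = 1`, vanishing at the other points
of the orbit, and an `N > n` with `T^N g = 0`. If `μ ≠ 0` is not in the spectrum, then
`(μ - T)⁻¹ g` is the finite sum `∑_{i < N} μ^{-(i + 1)} Tⁱ g`, whose value at `x` is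
`μ^{-(n + 1)} wₙ(x)`; hence `|wₙ(x)| ≤ C |μ|ⁿ` with `C` independent of `x` and `n`.

The resolvent set is open, so the same bound holds for some `ν` with `|ν| < |μ|`, and it passes
to `M`, the closure of `K \ L`. Thus `ρ(T, C(M)) ≤ |ν| < |μ|` as soon as `μ ≠ 0` avoids `σ(T)` or
`σ(T, C(M))`: both spectra contain the whole disk of radius `ρ(T, C(M))`. Outside the disk
`μ - T` is injective on `C(L ∩ M)`, so solutions of `μ f - T f = g` on `L` and on `M` agree on
`L ∩ M` and can be glued, which gives the equality of spectra there. -/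

namespace WeightedComposition

open Filter Function Set Topology
open scoped NNReal ENNReal

section BanachAlgebra

variable {𝕜 A : Type*} [NormedRing A] [CompleteSpace A] {a : A}

theorem spectralRadius_le_of_norm_pow_le [NormedField 𝕜] [NormedAlgebra 𝕜 A] {C : ℝ} {r : ℝ≥0}
    (h : ∀ n, ‖a ^ n‖ ≤ C * r ^ n) : spectralRadius 𝕜 a ≤ r := by
  refine iSup₂_le fun μ hμ => ?_
  by_contra! hlt
  have hr : r < ‖μ‖ := by exact_mod_cast hlt
  have hμ_pos : 0 < ‖μ‖ := r.2.trans_lt hr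
  have hpow (n : ℕ) : ‖μ‖ ^ n ≤ C * ‖(1 : A)‖ * r ^ n := calc
    ‖μ‖ ^ n = ‖μ ^ n‖ := (norm_pow μ n).symm
    _ ≤ ‖a ^ n‖ * ‖(1 : A)‖ := spectrum.norm_le_norm_mul_of_mem (spectrum.pow_mem_pow a n hμ)
    _ ≤ C * r ^ n * ‖(1 : A)‖ := by gcongr; exact h n
    _ = C * ‖(1 : A)‖ * r ^ n := by ring
  have hlim : Tendsto (fun n : ℕ => C * ‖(1 : A)‖ * (r / ‖μ‖) ^ n) atTop (𝓝 0) := by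
    simpa using (tendsto_pow_atTop_nhds_zero_of_lt_one (by positivity)
      ((div_lt_one hμ_pos).2 hr)).const_mul (C * ‖(1 : A)‖)
  refine zero_lt_one.not_ge (ge_of_tendsto' hlim fun n => ?_)
  rw [div_pow, mul_div_assoc', le_div_iff₀ (pow_pos hμ_pos n), one_mul]
  exact hpow n

theorem spectralRadius_le_spectralRadius_of_norm_pow_le {B : Type*} [NormedRing B]
    [CompleteSpace B] [NormedAlgebra ℂ A] [NormedAlgebra ℂ B] {b : B}
    (h : ∀ n, ‖a ^ n‖ ≤ ‖b ^ n‖) : spectralRadius ℂ a ≤ spectralRadius ℂ b :=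
  le_of_tendsto_of_tendsto' (spectrum.pow_nnnorm_pow_one_div_tendsto_nhds_spectralRadius a)
    (spectrum.pow_nnnorm_pow_one_div_tendsto_nhds_spectralRadius b) fun n => by
      gcongr
      exact h n

theorem exists_notMem_spectrum_norm_lt [NormedField 𝕜] [NormedSpace ℝ 𝕜] [NormedAlgebra 𝕜 A]
    {μ : 𝕜} (hμ0 : μ ≠ 0) (hμ : μ ∉ spectrum 𝕜 a) :
    ∃ ν ≠ 0, ‖ν‖ < ‖μ‖ ∧ ν ∉ spectrum 𝕜 a := by
  have hcl : μ ∈ closure (Metric.ball (0 : 𝕜) ‖μ‖) := by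
    rw [closure_ball _ (norm_ne_zero_iff.2 hμ0)]
    exact mem_closedBall_zero_iff.2 le_rfl
  obtain ⟨ν, ⟨hν, hν0⟩, hνμ⟩ := mem_closure_iff.1 hcl _
    ((spectrum.isClosed a).isOpen_compl.inter isOpen_compl_singleton) ⟨hμ, hμ0⟩
  exact ⟨ν, hν0, mem_ball_zero_iff.1 hνμ, hν⟩

theorem spectrum_eq_closedBall_of_forall_le [NormedField 𝕜] [ProperSpace 𝕜] [NormedAlgebra 𝕜 A]
    (h : ∀ μ : 𝕜, ‖μ‖₊ ≤ spectralRadius 𝕜 a → μ ∈ spectrum 𝕜 a) :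
    spectrum 𝕜 a = Metric.closedBall 0 (spectralRadius 𝕜 a).toReal := by
  obtain ⟨z, -, hz⟩ := spectrum.exists_nnnorm_eq_spectralRadius_of_nonempty ⟨0, h 0 (by simp)⟩
  ext μ
  have hball : μ ∈ Metric.closedBall 0 (spectralRadius 𝕜 a).toReal ↔
      ‖μ‖₊ ≤ spectralRadius 𝕜 a := by
    rw [mem_closedBall_zero_iff, ← hz, ENNReal.coe_toReal, ENNReal.coe_le_coe, coe_nnnorm]
    rfl
  exact ⟨fun hμ => hball.2 (le_iSup₂ (α := ℝ≥0∞) μ hμ), fun hμ => h μ (hball.1 hμ)⟩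

end BanachAlgebra

section Operator

variable {𝕜 E : Type*}

theorem resolvent_apply_of_pow_apply_eq_zero [NormedField 𝕜] [NormedAddCommGroup E]
    [NormedSpace 𝕜 E] {T : E →L[𝕜] E} {μ : 𝕜} (hμ0 : μ ≠ 0) (hμ : μ ∉ spectrum 𝕜 T) {g : E}
    {N : ℕ} (hg : (T ^ N) g = 0) :
    resolvent T μ g = ∑ i ∈ Finset.range N, μ⁻¹ ^ (i + 1) • (T ^ i) g := by
  set f := ∑ i ∈ Finset.range N, μ⁻¹ ^ (i + 1) • (T ^ i) g with hf
  have hfg : (algebraMap 𝕜 (E →L[𝕜] E) μ - T) f = g := by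
    have hterm (i : ℕ) : (algebraMap 𝕜 (E →L[𝕜] E) μ - T) (μ⁻¹ ^ (i + 1) • (T ^ i) g) =
        μ⁻¹ ^ i • (T ^ i) g - μ⁻¹ ^ (i + 1) • (T ^ (i + 1)) g := by
      rw [_root_.sub_apply, ContinuousLinearMap.algebraMap_apply, map_smul, smul_smul,
        pow_succ' μ⁻¹, mul_inv_cancel_left₀ hμ0, pow_succ' T, mul_apply_eq_comp]
    rw [hf, map_sum, Finset.sum_congr rfl fun i _ => hterm i, Finset.sum_range_sub', hg]
    simp
  have hinv : resolvent T μ * (algebraMap 𝕜 (E →L[𝕜] E) μ - T) = 1 :=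
    Ring.inverse_mul_cancel _ (spectrum.notMem_iff.1 hμ)
  calc resolvent T μ g = (resolvent T μ * (algebraMap 𝕜 (E →L[𝕜] E) μ - T)) f := by
        rw [mul_apply_eq_comp, hfg]
    _ = f := by rw [hinv, one_apply_eq_self]

theorem notMem_spectrum_iff_bijective [NontriviallyNormedField 𝕜] [NormedAddCommGroup E]
    [NormedSpace 𝕜 E] [CompleteSpace E] {T : E →L[𝕜] E} {μ : 𝕜} :
    μ ∉ spectrum 𝕜 T ↔ (∀ f, T f = μ • f → f = 0) ∧ ∀ g, ∃ f, μ • f - T f = g := by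
  rw [spectrum.notMem_iff, ContinuousLinearMap.isUnit_iff_bijective]
  refine and_congr ((injective_iff_map_eq_zero _).trans (forall_congr' fun f => ?_)) Iff.rfl
  rw [_root_.sub_apply, ContinuousLinearMap.algebraMap_apply, sub_eq_zero, eq_comm]

end Operator

section ContinuousMap

variable {X Y : Type*} [TopologicalSpace X] [TopologicalSpace Y]

theorem exists_continuousMap_eqOn_zero_apply_eq_one (𝕜 : Type*) [RCLike 𝕜] [CompactSpace X]
    [T2Space X] {S : Set X} (hS : IsClosed S) {x : X} (hx : x ∉ S) :
    ∃ g : C(X, 𝕜), EqOn g 0 S ∧ g x = 1 ∧ ‖g‖ ≤ 1 := by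
  obtain ⟨f, h0, h1, hf⟩ := exists_continuous_zero_one_of_isClosed hS isClosed_singleton
    (disjoint_singleton_right.2 hx)
  refine ⟨⟨fun y => (f y : 𝕜), by fun_prop⟩, fun y hy => ?_, ?_, ?_⟩
  · simpa using h0 hy
  · simpa using h1 (mem_singleton x)
  · refine (ContinuousMap.norm_le _ zero_le_one).2 fun y => ?_
    simpa [abs_of_nonneg (hf y).1] using (hf y).2

theorem ext_of_restrict {A B : Set X} (hAB : A ∪ B = univ) {f g : C(X, Y)}
    (hA : f.restrict A = g.restrict A) (hB : f.restrict B = g.restrict B) : f = g :=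
  ContinuousMap.ext fun x => (eq_univ_iff_forall.1 hAB x).elim
    (fun hx => DFunLike.congr_fun hA ⟨x, hx⟩) fun hx => DFunLike.congr_fun hB ⟨x, hx⟩

theorem exists_continuousMap_restrict_eq_of_union_eq_univ {A B : Set X} (hA : IsClosed A)
    (hB : IsClosed B) (hAB : A ∪ B = univ) (f : C(A, Y)) (g : C(B, Y))
    (hfg : ∀ x (hxA : x ∈ A) (hxB : x ∈ B), f ⟨x, hxA⟩ = g ⟨x, hxB⟩) :
    ∃ h : C(X, Y), h.restrict A = f ∧ h.restrict B = g := by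
  classical
  have hB_of_notMem : ∀ x ∉ A, x ∈ B := fun x hx => (eq_univ_iff_forall.1 hAB x).resolve_left hx
  let h : X → Y := fun x => if hx : x ∈ A then f ⟨x, hx⟩ else g ⟨x, hB_of_notMem x hx⟩
  have hA_eq : ∀ x : A, h x = f x := fun x => dif_pos x.2
  have hB_eq : ∀ x : B, h x = g x := fun x => by
    by_cases hx : (x : X) ∈ A
    · exact (dif_pos hx).trans (hfg x hx x.2)
    · exact dif_neg hx
  have hcont : Continuous h := by
    rw [← continuousOn_univ, ← hAB]
    refine ContinuousOn.union_of_isClosed ?_ ?_ hA hB <;>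
      rw [continuousOn_iff_continuous_domRestrict]
    · exact f.continuous.congr fun x => (hA_eq x).symm
    · exact g.continuous.congr fun x => (hB_eq x).symm
  exact ⟨⟨h, hcont⟩, ContinuousMap.ext hA_eq, ContinuousMap.ext hB_eq⟩

end ContinuousMap

section Cocycle

variable {X : Type*} [TopologicalSpace X]

/-- The cocycle `wₙ(x) = ∏_{k < n} w(φᵏ(x))`, the weight of the `n`-th power of the weighted
composition operator. -/
noncomputable def cocycle (w : C(X, ℂ)) (φ : C(X, X)) (n : ℕ) : C(X, ℂ) :=
  ∏ k ∈ Finset.range n, w.comp ⟨φ^[k], φ.continuous.iterate k⟩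

theorem cocycle_apply (w : C(X, ℂ)) (φ : C(X, X)) (n : ℕ) (x : X) :
    cocycle w φ n x = ∏ k ∈ Finset.range n, w (φ^[k] x) := by
  simp only [cocycle, ContinuousMap.prod_apply, ContinuousMap.comp_apply, ContinuousMap.coe_mk]

theorem cocycle_restrict (w : C(X, ℂ)) (φ : C(X, X)) {S : Set X} (hS : MapsTo φ S S) (n : ℕ) :
    cocycle (w.restrict S) ⟨hS.restrict φ S S, φ.continuous.restrict hS⟩ n =
      (cocycle w φ n).restrict S := by
  ext x
  simp only [cocycle_apply, ContinuousMap.restrict_apply, ContinuousMap.coe_mk,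
    hS.iterate_restrict, MapsTo.val_restrict_apply]

variable [CompactSpace X]

theorem op_pow_apply (w : C(X, ℂ)) (φ : C(X, X)) (n : ℕ) (f : C(X, ℂ)) (x : X) :
    (op w φ ^ n) f x = cocycle w φ n x * f (φ^[n] x) := by
  induction n generalizing f with
  | zero => simp [cocycle_apply]
  | succ n ih =>
    rw [pow_succ, mul_apply_eq_comp, ih, op_apply, cocycle_apply, cocycle_apply,
      Finset.prod_range_succ, iterate_succ_apply', mul_assoc]

theorem norm_op_pow (w : C(X, ℂ)) (φ : C(X, X)) (n : ℕ) : ‖op w φ ^ n‖ = ‖cocycle w φ n‖ := by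
  refine le_antisymm (ContinuousLinearMap.opNorm_le_bound _ (norm_nonneg _) fun f => ?_) ?_
  · refine (ContinuousMap.norm_le _ (by positivity)).2 fun x => ?_
    rw [op_pow_apply, norm_mul]
    gcongr <;> exact ContinuousMap.norm_coe_le_norm _ _
  · refine (ContinuousMap.norm_le _ (norm_nonneg _)).2 fun x => ?_
    calc ‖cocycle w φ n x‖ = ‖(op w φ ^ n) 1 x‖ := by rw [op_pow_apply]; simp
      _ ≤ ‖(op w φ ^ n) 1‖ := ContinuousMap.norm_coe_le_norm _ x
      _ ≤ ‖op w φ ^ n‖ * ‖(1 : C(X, ℂ))‖ := ContinuousLinearMap.le_opNorm _ _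
      _ ≤ ‖op w φ ^ n‖ * 1 := by
        gcongr
        exact (ContinuousMap.norm_le _ zero_le_one).2 fun y => by simp
      _ = ‖op w φ ^ n‖ := mul_one _

end Cocycle

section Restriction

variable {X : Type*} [TopologicalSpace X] {w : C(X, ℂ)} {φ : C(X, X)}

theorem opOn_restrict [CompactSpace X] {S : Set X} [CompactSpace S] (hS : MapsTo φ S S)
    (f : C(X, ℂ)) : opOn w φ S hS (f.restrict S) = (op w φ f).restrict S := rfl

theorem norm_opOn_pow {S : Set X} [CompactSpace S] (hS : MapsTo φ S S) (n : ℕ) :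
    ‖opOn w φ S hS ^ n‖ = ‖(cocycle w φ n).restrict S‖ := by
  rw [opOn, norm_op_pow, cocycle_restrict]

theorem spectralRadius_opOn_mono {S S' : Set X} [CompactSpace S] [CompactSpace S']
    (hS : MapsTo φ S S) (hS' : MapsTo φ S' S') (hSS' : S ⊆ S') :
    spectralRadius ℂ (opOn w φ S hS) ≤ spectralRadius ℂ (opOn w φ S' hS') := by
  refine spectralRadius_le_spectralRadius_of_norm_pow_le (a := opOn w φ S hS)
    (b := opOn w φ S' hS') fun n => ?_
  rw [norm_opOn_pow, norm_opOn_pow]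
  exact (ContinuousMap.norm_le _ (norm_nonneg _)).2 fun x =>
    ((cocycle w φ n).restrict S').norm_coe_le_norm ⟨x, hSS' x.2⟩

theorem spectralRadius_opOn_le {S D : Set X} [CompactSpace S] (hS : MapsTo φ S S)
    (hSD : S ⊆ closure D) {C : ℝ} {r : ℝ≥0}
    (h : ∀ x ∈ D, ∀ n, ‖cocycle w φ n x‖ ≤ C * r ^ n) :
    spectralRadius ℂ (opOn w φ S hS) ≤ r := by
  have hclosure : ∀ x ∈ closure D, ∀ n, ‖cocycle w φ n x‖ ≤ C * r ^ n := fun x hx n =>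
    closure_minimal (fun y hy => h y hy n)
      (isClosed_le (cocycle w φ n).continuous.norm continuous_const) hx
  refine spectralRadius_le_of_norm_pow_le (a := opOn w φ S hS) (C := max C 0) fun n => ?_
  rw [norm_opOn_pow]
  refine (ContinuousMap.norm_le _ (by positivity)).2 fun x => (hclosure x (hSD x.2) n).trans ?_
  gcongr
  exact le_max_left C 0

end Restriction

section Orbits

variable {X : Type*} [TopologicalSpace X] {φ : C(X, X)} {x : X}

theorem periodicPts_subset_L (φ : C(X, X)) : periodicPts φ ⊆ L φ := fun _ hx =>
  mem_iInter.2 fun n =>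
    ((bijOn_periodicPts (φ : X → X)).surjOn.iterate n |>.subset_range) hx

theorem iterate_injective_of_notMem_L (hφ : Injective φ) (hx : x ∉ L φ) :
    Injective fun n : ℕ => φ^[n] x := by
  have hne {m n : ℕ} (hmn : m < n) : φ^[n] x ≠ φ^[m] x := fun h =>
    hx (periodicPts_subset_L φ (mk_mem_periodicPts (Nat.sub_pos_of_lt hmn)
      (iterate_cancel hφ h)))
  intro m n h
  rcases lt_trichotomy m n with hmn | hmn | hmn
  exacts [(hne hmn h.symm).elim, hmn, (hne hmn h).elim]

theorem exists_iterate_notMem_range (hφ : Injective φ) (hx : x ∉ L φ) (n : ℕ) :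
    ∃ N > n, φ^[n] x ∉ range φ^[N] := by
  obtain ⟨m, hm⟩ : ∃ m, x ∉ range φ^[m] := by simpa only [L, mem_iInter, not_forall] using hx
  have hm0 : m ≠ 0 := by
    rintro rfl
    exact hm ⟨x, rfl⟩
  refine ⟨n + m, by lia, ?_⟩
  rintro ⟨y, hy⟩
  rw [iterate_add_apply] at hy
  exact hm ⟨y, hφ.iterate n hy⟩

theorem exists_continuousMap_orbit_eq_single [CompactSpace X] [T2Space X] (hφ : Injective φ)
    (hx : x ∉ L φ) (n : ℕ) :
    ∃ g : C(X, ℂ), ∃ N > n, ‖g‖ ≤ 1 ∧ (∀ y, g (φ^[N] y) = 0) ∧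
      ∀ i, g (φ^[i] x) = Pi.single (M := fun _ => ℂ) n 1 i := by
  obtain ⟨N, hnN, hN⟩ := exists_iterate_notMem_range hφ hx n
  have horbit : φ^[n] x ∉ (fun i : ℕ => φ^[i] x) '' (Iio N \ {n}) := by
    rintro ⟨i, ⟨-, hi⟩, hin⟩
    exact hi (iterate_injective_of_notMem_L hφ hx hin)
  obtain ⟨g, hg0, hg1, hg⟩ := exists_continuousMap_eqOn_zero_apply_eq_one ℂ
    ((isCompact_range (φ.continuous.iterate N)).isClosed.union
      (((finite_Iio N).sdiff).image _).isClosed) (not_or_intro hN horbit)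
  refine ⟨g, N, hnN, hg, fun y => hg0 (Or.inl ⟨y, rfl⟩), fun i => ?_⟩
  rcases eq_or_ne i n with rfl | hi
  · rw [hg1, Pi.single_eq_same]
  rw [Pi.single_eq_of_ne hi]
  rcases lt_or_ge i N with hiN | hiN
  · exact hg0 (Or.inr ⟨i, ⟨hiN, hi⟩, rfl⟩)
  · refine hg0 (Or.inl ⟨φ^[i - N] x, ?_⟩)
    rw [← iterate_add_apply, Nat.add_sub_cancel' hiN]

theorem norm_cocycle_le [CompactSpace X] [T2Space X] (hφ : Injective φ) {w : C(X, ℂ)} {μ : ℂ}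
    (hμ0 : μ ≠ 0) (hμ : μ ∉ spectrum ℂ (op w φ)) (hx : x ∉ L φ) (n : ℕ) :
    ‖cocycle w φ n x‖ ≤ ‖resolvent (op w φ) μ‖ * ‖μ‖ * ‖μ‖ ^ n := by
  obtain ⟨g, N, hnN, hg, hgN, hgx⟩ := exists_continuousMap_orbit_eq_single hφ hx n
  have hpow : (op w φ ^ N) g = 0 := by
    ext y
    rw [op_pow_apply, hgN, mul_zero, ContinuousMap.zero_apply]
  have hresolvent : μ ^ (n + 1) * resolvent (op w φ) μ g x = cocycle w φ n x := by
    rw [resolvent_apply_of_pow_apply_eq_zero hμ0 hμ hpow, ContinuousMap.sum_apply,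
      Finset.sum_eq_single_of_mem n (Finset.mem_range.2 hnN) fun i _ hi => ?_]
    · rw [ContinuousMap.smul_apply, op_pow_apply, hgx, Pi.single_eq_same, mul_one, smul_eq_mul,
        inv_pow, mul_inv_cancel_left₀ (pow_ne_zero _ hμ0)]
    · rw [ContinuousMap.smul_apply, op_pow_apply, hgx, Pi.single_eq_of_ne hi, mul_zero, smul_zero]
  calc ‖cocycle w φ n x‖ = ‖μ‖ ^ (n + 1) * ‖resolvent (op w φ) μ g x‖ := by
        rw [← hresolvent, norm_mul, norm_pow]
    _ ≤ ‖μ‖ ^ (n + 1) * (‖resolvent (op w φ) μ‖ * ‖g‖) := by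
        gcongr
        exact (ContinuousMap.norm_coe_le_norm _ x).trans (ContinuousLinearMap.le_opNorm _ g)
    _ ≤ ‖μ‖ ^ (n + 1) * (‖resolvent (op w φ) μ‖ * 1) := by gcongr
    _ = ‖resolvent (op w φ) μ‖ * ‖μ‖ * ‖μ‖ ^ n := by ring

end Orbits

section Gluing

variable {X : Type*} [TopologicalSpace X] {w : C(X, ℂ)} {φ : C(X, X)} {A B I : Set X}
  [CompactSpace A] [CompactSpace B] [CompactSpace I] {μ : ℂ}

theorem eq_of_sub_opOn_eq (hA : MapsTo φ A A) (hB : MapsTo φ B B) (hI : MapsTo φ I I)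
    (hAB : A ∩ B = I) (hinj : ∀ f, opOn w φ I hI f = μ • f → f = 0) {f : C(A, ℂ)} {g : C(B, ℂ)}
    (hfg : ∀ x (hxA : x ∈ A) (hxB : x ∈ B),
      (μ • f - opOn w φ A hA f) ⟨x, hxA⟩ = (μ • g - opOn w φ B hB g) ⟨x, hxB⟩) :
    ∀ x (hxA : x ∈ A) (hxB : x ∈ B), f ⟨x, hxA⟩ = g ⟨x, hxB⟩ := by
  subst hAB
  let d : C(↑(A ∩ B), ℂ) := f.comp ⟨inclusion inter_subset_left, by fun_prop⟩ -
    g.comp ⟨inclusion inter_subset_right, by fun_prop⟩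
  have hd : d = 0 := hinj d <| ContinuousMap.ext fun x => by
    have h : μ * f ⟨x, x.2.1⟩ - w x * f ⟨φ x, hA x.2.1⟩ =
        μ * g ⟨x, x.2.2⟩ - w x * g ⟨φ x, hB x.2.2⟩ := hfg x x.2.1 x.2.2
    change w x * (f ⟨φ x, hA x.2.1⟩ - g ⟨φ x, hB x.2.2⟩) =
      μ * (f ⟨x, x.2.1⟩ - g ⟨x, x.2.2⟩)
    linear_combination -h
  exact fun x hxA hxB => sub_eq_zero.1 (DFunLike.congr_fun hd ⟨x, hxA, hxB⟩)

variable [CompactSpace X] [T2Space X]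

theorem notMem_spectrum_opOn_of_notMem_spectrum_op (hA : MapsTo φ A A) (hB : MapsTo φ B B)
    (hI : MapsTo φ I I) (hAB : A ∩ B = I) (hinj : ∀ f, opOn w φ I hI f = μ • f → f = 0)
    (hunion : A ∪ B = univ) (hμ : μ ∉ spectrum ℂ (op w φ)) :
    μ ∉ spectrum ℂ (opOn w φ A hA) := by
  have hA_closed : IsClosed A := (isCompact_iff_compactSpace.2 inferInstance).isClosed
  have hB_closed : IsClosed B := (isCompact_iff_compactSpace.2 inferInstance).isClosed
  obtain ⟨hop_inj, hop_surj⟩ := notMem_spectrum_iff_bijective.1 hμ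
  refine notMem_spectrum_iff_bijective.2 ⟨fun f hf => ?_, fun g => ?_⟩
  · have hf_zero : ∀ x (hxA : x ∈ A) (hxB : x ∈ B), f ⟨x, hxA⟩ = (0 : C(B, ℂ)) ⟨x, hxB⟩ :=
      eq_of_sub_opOn_eq hA hB hI hAB hinj fun x hxA hxB => by simp [hf]
    obtain ⟨h, rfl, hB_zero⟩ :=
      exists_continuousMap_restrict_eq_of_union_eq_univ hA_closed hB_closed hunion f 0 hf_zero
    have hh : h = 0 := hop_inj h <| ext_of_restrict hunion hf <| by
      rw [← opOn_restrict hB, hB_zero, map_zero]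
      exact (smul_zero μ).symm.trans (congrArg (μ • ·) hB_zero.symm)
    rw [hh]
    rfl
  · obtain ⟨G, rfl⟩ := ContinuousMap.exists_restrict_eq hA_closed g
    obtain ⟨h, rfl⟩ := hop_surj G
    exact ⟨h.restrict A, rfl⟩

theorem notMem_spectrum_op_of_notMem_spectrum_opOn (hA : MapsTo φ A A) (hB : MapsTo φ B B)
    (hI : MapsTo φ I I) (hAB : A ∩ B = I) (hinj : ∀ f, opOn w φ I hI f = μ • f → f = 0)
    (hunion : A ∪ B = univ) (hμA : μ ∉ spectrum ℂ (opOn w φ A hA))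
    (hμB : μ ∉ spectrum ℂ (opOn w φ B hB)) : μ ∉ spectrum ℂ (op w φ) := by
  have hA_closed : IsClosed A := (isCompact_iff_compactSpace.2 inferInstance).isClosed
  have hB_closed : IsClosed B := (isCompact_iff_compactSpace.2 inferInstance).isClosed
  obtain ⟨hA_inj, hA_surj⟩ := notMem_spectrum_iff_bijective.1 hμA
  obtain ⟨hB_inj, hB_surj⟩ := notMem_spectrum_iff_bijective.1 hμB
  refine notMem_spectrum_iff_bijective.2 ⟨fun f hf => ?_, fun g => ?_⟩
  · exact ext_of_restrict hunion (hA_inj _ (congrArg (ContinuousMap.restrict A) hf))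
      (hB_inj _ (congrArg (ContinuousMap.restrict B) hf))
  · obtain ⟨fA, hfA⟩ := hA_surj (g.restrict A)
    obtain ⟨fB, hfB⟩ := hB_surj (g.restrict B)
    obtain ⟨f, rfl, rfl⟩ := exists_continuousMap_restrict_eq_of_union_eq_univ hA_closed hB_closed
      hunion fA fB (eq_of_sub_opOn_eq hA hB hI hAB hinj fun x hxA hxB => by rw [hfA, hfB]; rfl)
    exact ⟨f, ext_of_restrict hunion hfA hfB⟩

theorem mem_spectrum_op_iff_of_union_eq_univ (hA : MapsTo φ A A) (hB : MapsTo φ B B)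
    (hI : MapsTo φ I I) (hAB : A ∩ B = I) (hinj : ∀ f, opOn w φ I hI f = μ • f → f = 0)
    (hunion : A ∪ B = univ) : μ ∈ spectrum ℂ (op w φ) ↔
      μ ∈ spectrum ℂ (opOn w φ A hA) ∪ spectrum ℂ (opOn w φ B hB) := by
  rw [← not_iff_not, mem_union, not_or]
  exact ⟨fun hμ =>
    ⟨notMem_spectrum_opOn_of_notMem_spectrum_op hA hB hI hAB hinj hunion hμ,
      notMem_spectrum_opOn_of_notMem_spectrum_op hB hA hI ((inter_comm B A).trans hAB) hinj
        ((union_comm B A).trans hunion) hμ⟩,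
    fun hμ => notMem_spectrum_op_of_notMem_spectrum_opOn hA hB hI hAB hinj hunion hμ.1 hμ.2⟩

end Gluing

section Disk

variable {X : Type*} [TopologicalSpace X] {w : C(X, ℂ)} {φ : C(X, X)}

theorem M_eq_closure_compl_L (φ : C(X, X)) : M φ = closure (L φ)ᶜ := closure_compl.symm

theorem compl_L_subset_M (φ : C(X, X)) : (L φ)ᶜ ⊆ M φ := compl_subset_compl.2 interior_subset

theorem M_union_L (φ : C(X, X)) : M φ ∪ L φ = univ :=
  eq_univ_of_subset (union_subset_union_left _ (compl_L_subset_M φ)) (compl_union_self (L φ))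

theorem L_subset_range (φ : C(X, X)) : L φ ⊆ range φ := iInter_subset (fun n => range φ^[n]) 1

theorem coe_mem_L_of_mem_L_restrict {S : Set X} (hS : MapsTo φ S S) {x : S}
    (hx : x ∈ L ⟨hS.restrict φ S S, φ.continuous.restrict hS⟩) : (x : X) ∈ L φ := by
  refine mem_iInter.2 fun n => ?_
  obtain ⟨y, rfl⟩ := mem_iInter.1 hx n
  refine ⟨y, ?_⟩
  simp only [ContinuousMap.coe_mk, hS.iterate_restrict, MapsTo.val_restrict_apply]

theorem not_surjective_restrict_M (hφ : Injective φ) (hns : ¬ Surjective φ) :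
    ¬ Surjective ((mapsTo_M φ hφ).restrict φ (M φ) (M φ)) := fun hsurj => hns fun x => by
  by_contra hx
  obtain ⟨y, hy⟩ := hsurj ⟨x, compl_L_subset_M φ fun hxL => hx (L_subset_range φ hxL)⟩
  exact hx ⟨y, congrArg Subtype.val hy⟩

variable [CompactSpace X] [T2Space X] {μ : ℂ}

theorem zero_mem_spectrum_op (hns : ¬ Surjective φ) : 0 ∈ spectrum ℂ (op w φ) := by
  obtain ⟨x, hx⟩ := not_forall.1 hns
  obtain ⟨g, hg0, hg1, -⟩ := exists_continuousMap_eqOn_zero_apply_eq_one ℂ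
    (isCompact_range φ.continuous).isClosed hx
  by_contra h0
  have hg : g = 0 := (notMem_spectrum_iff_bijective.1 h0).1 g <| ContinuousMap.ext fun y => by
    rw [op_apply, hg0 (mem_range_self y), zero_smul, Pi.zero_apply, mul_zero,
      ContinuousMap.zero_apply]
  exact one_ne_zero (hg1.symm.trans (DFunLike.congr_fun hg x))

theorem exists_forall_norm_cocycle_le (hφ : Injective φ) (hμ0 : μ ≠ 0)
    (hμ : μ ∉ spectrum ℂ (op w φ)) :
    ∃ C, ∃ r < ‖μ‖₊, ∀ x ∉ L φ, ∀ n, ‖cocycle w φ n x‖ ≤ C * r ^ n := by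
  have hexists := exists_notMem_spectrum_norm_lt (a := op w φ) hμ0 hμ
  obtain ⟨ν, hν0, hνμ, hν⟩ := hexists
  exact ⟨‖resolvent (op w φ) ν‖ * ‖ν‖, ‖ν‖₊, hνμ, fun _ hx => norm_cocycle_le hφ hν0 hν hx⟩

theorem mem_spectrum_op_of_le_spectralRadius (hφ : Injective φ) (hns : ¬ Surjective φ)
    (hμ : ‖μ‖₊ ≤ spectralRadius ℂ (opOn w φ (M φ) (mapsTo_M φ hφ))) :
    μ ∈ spectrum ℂ (op w φ) := by
  rcases eq_or_ne μ 0 with rfl | hμ0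
  · exact zero_mem_spectrum_op hns
  by_contra hμ_op
  obtain ⟨C, r, hr, hC⟩ := exists_forall_norm_cocycle_le hφ hμ0 hμ_op
  exact hr.not_ge (ENNReal.coe_le_coe.1 (hμ.trans
    (spectralRadius_opOn_le (mapsTo_M φ hφ) (M_eq_closure_compl_L φ).subset hC)))

theorem mem_spectrum_opOn_M_of_le_spectralRadius (hφ : Injective φ) (hns : ¬ Surjective φ)
    (hμ : ‖μ‖₊ ≤ spectralRadius ℂ (opOn w φ (M φ) (mapsTo_M φ hφ))) :
    μ ∈ spectrum ℂ (opOn w φ (M φ) (mapsTo_M φ hφ)) := by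
  rcases eq_or_ne μ 0 with rfl | hμ0
  · exact zero_mem_spectrum_op (not_surjective_restrict_M hφ hns)
  by_contra hμ_M
  obtain ⟨C, r, hr, hC⟩ := exists_forall_norm_cocycle_le
    ((mapsTo_M φ hφ).restrict_inj.2 hφ.injOn) hμ0 hμ_M
  have hC_X : ∀ x ∈ (L φ)ᶜ, ∀ n, ‖cocycle w φ n x‖ ≤ C * r ^ n := fun x hx n => by
    simpa only [cocycle_restrict, ContinuousMap.restrict_apply] using hC ⟨x, compl_L_subset_M φ hx⟩
      (fun hxL => hx (coe_mem_L_of_mem_L_restrict (mapsTo_M φ hφ) hxL)) n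
  exact hr.not_ge (ENNReal.coe_le_coe.1 (hμ.trans
    (spectralRadius_opOn_le (mapsTo_M φ hφ) (M_eq_closure_compl_L φ).subset hC_X)))

theorem spectrum_opOn_M_eq_closedBall (hφ : Injective φ) (hns : ¬ Surjective φ) :
    spectrum ℂ (opOn w φ (M φ) (mapsTo_M φ hφ)) =
      Metric.closedBall 0 (spectralRadius ℂ (opOn w φ (M φ) (mapsTo_M φ hφ))).toReal :=
  spectrum_eq_closedBall_of_forall_le (a := opOn w φ (M φ) (mapsTo_M φ hφ)) fun _ =>
    mem_spectrum_opOn_M_of_le_spectralRadius hφ hns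

theorem spectrum_op_eq_union (hφ : Injective φ) (hns : ¬ Surjective φ) :
    spectrum ℂ (op w φ) = spectrum ℂ (opOn w φ (M φ) (mapsTo_M φ hφ)) ∪
      spectrum ℂ (opOn w φ (L φ) (mapsTo_L φ)) := by
  ext μ
  rcases le_or_gt (‖μ‖₊ : ℝ≥0∞) (spectralRadius ℂ (opOn w φ (M φ) (mapsTo_M φ hφ)))
    with hμ | hμ
  · exact iff_of_true (mem_spectrum_op_of_le_spectralRadius hφ hns hμ)
      (Or.inl (mem_spectrum_opOn_M_of_le_spectralRadius hφ hns hμ))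
  have : CompactSpace ↑(M φ ∩ L φ) := isCompact_iff_compactSpace.1 <|
    (isCompact_iff_compactSpace.2 (compactSpace_M φ)).inter
      (isCompact_iff_compactSpace.2 (compactSpace_L φ))
  have hinter : MapsTo φ (M φ ∩ L φ) (M φ ∩ L φ) := (mapsTo_M φ hφ).inter_inter (mapsTo_L φ)
  have hμ_inter : μ ∉ spectrum ℂ (opOn w φ (M φ ∩ L φ) hinter) :=
    notMem_compl_iff.2 <| spectrum.mem_resolventSet_of_spectralRadius_lt
      ((spectralRadius_opOn_mono hinter (mapsTo_M φ hφ) inter_subset_left).trans_lt hμ)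
  exact mem_spectrum_op_iff_of_union_eq_univ (mapsTo_M φ hφ) (mapsTo_L φ) hinter rfl
    (notMem_spectrum_iff_bijective.1 hμ_inter).1 (M_union_L φ)

end Disk

end WeightedComposition

theorem theorem1 {K : Type*} [TopologicalSpace K] [CompactSpace K] [T2Space K]
    (φ : C(K, K)) (hφ : Topology.IsEmbedding φ) (hns : Set.range φ ⊂ Set.univ) (w : C(K, ℂ)) :
    (spectrum ℂ (WeightedComposition.opOn w φ (WeightedComposition.M φ) (WeightedComposition.mapsTo_M φ hφ.injective)) =
        Metric.closedBall (0 : ℂ)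
          (spectralRadius ℂ (WeightedComposition.opOn w φ (WeightedComposition.M φ) (WeightedComposition.mapsTo_M φ hφ.injective))).toReal ∨
      spectrum ℂ (WeightedComposition.opOn w φ (WeightedComposition.M φ) (WeightedComposition.mapsTo_M φ hφ.injective)) = {0}) ∧
    spectrum ℂ (WeightedComposition.op w φ) =
      spectrum ℂ (WeightedComposition.opOn w φ (WeightedComposition.M φ) (WeightedComposition.mapsTo_M φ hφ.injective)) ∪
        spectrum ℂ (WeightedComposition.opOn w φ (WeightedComposition.L φ) (WeightedComposition.mapsTo_L φ)) := by
  have hsurj : ¬ Function.Surjective φ := fun h => hns.ne h.range_eq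
  exact ⟨Or.inl (WeightedComposition.spectrum_opOn_M_eq_closedBall hφ.injective hsurj),
    WeightedComposition.spectrum_op_eq_union hφ.injective hsurj⟩
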